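/- For $s\in(0,1)$ and $\theta\in(0,\pi)$ let $$M(\theta,s)=2\int_0^\theta\left[\int_0^{+\infty}\frac{r\,dr}{(r^2+2r\cos t+1)^{\frac{2+s}{2}}}\right]dt .$$ For every $s\in(0,1)$ and $\sigma\in(-1,1)$ the equation (fractional Young's law) $$1+\sigma=(\sin\theta)^s\,\frac{M(\theta,s)}{M\left(\frac\pi2,s\right)}$$ has exactly one solution $\theta=\theta(s,\sigma)\in(0,\pi)$. For every $s\in(0,1)$ the function $\theta(s,\cdot)$ is strictly increasing on $(-1,1)$, and for every $\sigma\in(-1,1)$ we have $$\theta(s,\sigma)=\arccos(-\sigma)-\frac{2\sigma\log 2+(1-\sigma)\log(1-\sigma)-(1+\sigma)\log(1+\sigma)}{2\sqrt{1-\sigma^2}}\,(1-s)+o(1-s)\qquad\text{as } s\to1^-,$$ and $$\theta(s,\sigma)=\frac\pi2(1+\sigma)-\left[\frac\pi2(1+\sigma)\log\left(\cos\frac{\pi\sigma}2\right)-\Xi\left(\frac\pi2(1+\sigma)\right)+(1+\sigma)\,\Xi\left(\frac\pi2\right)\right]s+o(s)\qquad\text{as } s\to0^+,$$ where $\Xi(\alpha)=\int_0^\alpha\frac{t}{\tan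 t}\,dt$ for $\alpha\in[0,\pi)$. -/

import Mathlib

noncomputable section

/-- `M(θ, s) = 2 ∫₀^θ ∫₀^∞ r / (r² + 2 r cos t + 1)^((2+s)/2) dr dt`. -/
def youngM (θ s : ℝ) : ℝ :=
  2 * ∫ t in (0 : ℝ)..θ, ∫ r in Set.Ioi (0 : ℝ),
    r / (r ^ 2 + 2 * r * Real.cos t + 1) ^ ((2 + s) / 2)

/-- `α` is an angle in `(0, π)` that solves the fractional Young's law with
fractional parameter `s` and relative adhesion coefficient `σ`. -/
def IsContactAngle (s σ α : ℝ) : Prop :=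
  α ∈ Set.Ioo 0 Real.pi ∧
    1 + σ = Real.sin α ^ s * (youngM α s / youngM (Real.pi / 2) s)

/-- The fractional contact angle `θ(s, σ)`: the solution of the fractional Young's law.
(Arbitrary where there is no solution; that the solution exists and is unique for
`s ∈ (0, 1)` and `σ ∈ (-1, 1)` has to be proved.) -/
def contactAngle (s σ : ℝ) : ℝ :=
  Classical.epsilon (IsContactAngle s σ)

/-- `Ξ(α) = ∫₀^α t / tan t dt`. -/
def youngXi (α : ℝ) : ℝ :=
  ∫ t in (0 : ℝ)..α, t / Real.tan t

end

/-!
Write `Φ_s(θ) = ∫₀^θ (sin φ)^s dφ`. Taking `ψ = arg (r + e^{it})` as the variable of integration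
evaluates the radial integral in `M` and shows that it equals `d/dt [Φ_s(t) / (s (sin t)^s)]`. Hence
`M(θ, s) = 2 Φ_s(θ) / (s (sin θ)^s)`, and the fractional Young's law becomes
`Φ_s(θ) = (1 + σ) Φ_s(π / 2)`. Since `Φ_s` increases strictly from `0` to `Φ_s(π) = 2 Φ_s(π / 2)`,
this has exactly one solution, which increases with `σ`.

The reduced equation still makes sense at `s = 0`, so both expansions follow by differentiating it
implicitly in `s`: at `s = 1` and `s = 0` it is solved explicitly, because `Φ_1(θ) = 1 - cos θ` and
`Φ_0(θ) = θ`. The derivative in `s` brings in `∫ sin φ log (sin φ) dφ`, which is elementary, and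
`∫ log (sin φ) dφ`, which becomes `Ξ` after an integration by parts.
-/

open Real Set Filter Topology MeasureTheory

section MeanValue

theorem exists_mem_uIcc_sub_eq_mul_sub {f f' : ℝ → ℝ} (hf : ∀ x, HasDerivAt f (f' x) x)
    (a b : ℝ) : ∃ ξ ∈ uIcc a b, f b - f a = f' ξ * (b - a) := by
  wlog hab : a < b generalizing a b
  · rcases (not_lt.1 hab).eq_or_lt with rfl | hba
    · exact ⟨b, left_mem_uIcc, by simp⟩
    · obtain ⟨ξ, hξ, h⟩ := this b a hba
      exact ⟨ξ, uIcc_comm b a ▸ hξ, by linarith⟩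
  obtain ⟨ξ, hξ, h⟩ := exists_hasDerivAt_eq_slope f f' hab
    (fun x _ => (hf x).continuousAt.continuousWithinAt) fun x _ => hf x
  exact ⟨ξ, Icc_subset_uIcc (Ioo_subset_Icc_self hξ),
    ((eq_div_iff (sub_pos.2 hab).ne').1 h).symm⟩

/- Everything is relative to `S` because the application at `s = 0` is one-sided, which rules out
the implicit function theorem. -/
theorem hasDerivWithinAt_implicit {G G' : ℝ → ℝ → ℝ} {θ : ℝ → ℝ} {S : Set ℝ} {s₀ k : ℝ}
    (hs₀ : s₀ ∈ S) (hθ : ContinuousWithinAt θ S s₀) (h : ∀ s ∈ S, G s (θ s) = 0)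
    (hG : ∀ s ∈ S, ∀ x, HasDerivAt (G s) (G' s x) x)
    (hG' : ContinuousWithinAt (Function.uncurry G') (S ×ˢ univ) (s₀, θ s₀))
    (hne : G' s₀ (θ s₀) ≠ 0) (hk : HasDerivWithinAt (fun s => G s (θ s₀)) k S s₀) :
    HasDerivWithinAt θ (-k / G' s₀ (θ s₀)) S s₀ := by
  choose! ξ hξ hξ_eq using fun s (hs : s ∈ S) =>
    exists_mem_uIcc_sub_eq_mul_sub (hG s hs) (θ s₀) (θ s)
  have hξ_lim : Tendsto ξ (𝓝[S] s₀) (𝓝 (θ s₀)) := by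
    rw [tendsto_iff_norm_sub_tendsto_zero]
    refine squeeze_zero' (Eventually.of_forall fun _ => norm_nonneg _) ?_
      (tendsto_iff_norm_sub_tendsto_zero.1 hθ)
    filter_upwards [self_mem_nhdsWithin] with s hs using abs_sub_left_of_mem_uIcc (hξ s hs)
  have hG'ξ : Tendsto (fun s => G' s (ξ s)) (𝓝[S] s₀) (𝓝 (G' s₀ (θ s₀))) := by
    refine hG'.tendsto.comp (tendsto_nhdsWithin_iff.2
      ⟨(tendsto_id.mono_left nhdsWithin_le_nhds).prodMk_nhds hξ_lim, ?_⟩)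
    filter_upwards [self_mem_nhdsWithin] with s hs using ⟨hs, mem_univ _⟩
  have hle : 𝓝[S \ {s₀}] s₀ ≤ 𝓝[S] s₀ := nhdsWithin_mono _ sdiff_subset
  rw [hasDerivWithinAt_iff_tendsto_slope] at hk ⊢
  refine (hk.neg.div (hG'ξ.mono_left hle) hne).congr' ?_
  filter_upwards [self_mem_nhdsWithin, hle (hG'ξ.eventually_ne hne)] with s hs hs'
  have hmul := hξ_eq s hs.1
  rw [h s hs.1] at hmul
  simp only [Pi.div_apply, slope_def_field, h s₀ hs₀]
  rw [div_eq_iff hs', div_mul_eq_mul_div, ← neg_div]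
  congr 1
  linarith

end MeanValue

section SinRpowIntegral

/-- The function `Φ_s(θ) = ∫₀^θ (sin φ)^s dφ`, in terms of which the fractional Young's law reads
`Φ_s(θ) = (1 + σ) Φ_s(π / 2)`. -/
noncomputable def sinRpowIntegral (s θ : ℝ) : ℝ := ∫ φ in (0 : ℝ)..θ, sin φ ^ s

variable {s θ : ℝ}

theorem continuous_sin_rpow (hs : 0 ≤ s) : Continuous fun φ : ℝ => sin φ ^ s :=
  continuous_sin.rpow_const fun _ => Or.inr hs

theorem intervalIntegrable_sin_rpow (hs : 0 ≤ s) (a b : ℝ) :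
    IntervalIntegrable (fun φ => sin φ ^ s) volume a b :=
  (continuous_sin_rpow hs).intervalIntegrable a b

theorem hasDerivAt_sinRpowIntegral (hs : 0 ≤ s) (θ : ℝ) :
    HasDerivAt (sinRpowIntegral s) (sin θ ^ s) θ :=
  ((continuous_sin_rpow hs).integral_hasStrictDerivAt 0 θ).hasDerivAt

theorem continuous_sinRpowIntegral (hs : 0 ≤ s) : Continuous (sinRpowIntegral s) :=
  continuous_iff_continuousAt.2 fun θ => (hasDerivAt_sinRpowIntegral hs θ).continuousAt

theorem strictMonoOn_sinRpowIntegral (hs : 0 ≤ s) :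
    StrictMonoOn (sinRpowIntegral s) (Icc 0 π) := by
  refine strictMonoOn_of_deriv_pos (convex_Icc _ _) (continuous_sinRpowIntegral hs).continuousOn
    fun x hx => ?_
  rw [interior_Icc] at hx
  rw [(hasDerivAt_sinRpowIntegral hs x).deriv]
  exact rpow_pos_of_pos (sin_pos_of_mem_Ioo hx) _

@[simp]
theorem sinRpowIntegral_apply_zero (s : ℝ) : sinRpowIntegral s 0 = 0 :=
  intervalIntegral.integral_same

theorem sinRpowIntegral_apply_pi (hs : 0 ≤ s) :
    sinRpowIntegral s π = 2 * sinRpowIntegral s (π / 2) := by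
  have hreflect : ∫ φ in (π / 2)..π, sin φ ^ s = ∫ φ in (0 : ℝ)..(π / 2), sin φ ^ s := by
    have := intervalIntegral.integral_comp_sub_left (a := 0) (b := π / 2)
      (fun φ : ℝ => sin φ ^ s) π
    simpa only [sin_pi_sub, sub_zero, sub_half] using this.symm
  rw [sinRpowIntegral, ← intervalIntegral.integral_add_adjacent_intervals
    (intervalIntegrable_sin_rpow hs 0 (π / 2)) (intervalIntegrable_sin_rpow hs (π / 2) π),
    hreflect, ← two_mul, sinRpowIntegral]

theorem sinRpowIntegral_pos (hs : 0 ≤ s) (hθ : θ ∈ Ioc 0 π) : 0 < sinRpowIntegral s θ :=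
  sinRpowIntegral_apply_zero s ▸ strictMonoOn_sinRpowIntegral hs (left_mem_Icc.2 pi_pos.le)
    (Ioc_subset_Icc_self hθ) hθ.1

theorem pi_div_two_mem_Ioo : π / 2 ∈ Ioo 0 π := ⟨half_pos pi_pos, half_lt_self pi_pos⟩

theorem sinRpowIntegral_pi_div_two_pos (hs : 0 ≤ s) : 0 < sinRpowIntegral s (π / 2) :=
  sinRpowIntegral_pos hs (Ioo_subset_Ioc_self pi_div_two_mem_Ioo)

theorem sinRpowIntegral_zero (θ : ℝ) : sinRpowIntegral 0 θ = θ := by simp [sinRpowIntegral]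

theorem sinRpowIntegral_one (θ : ℝ) : sinRpowIntegral 1 θ = 1 - cos θ := by
  simp [sinRpowIntegral]

theorem sinRpowIntegral_le_mul_sin_rpow (hs : 0 ≤ s) (hθ : θ ∈ Icc 0 (π / 2)) :
    sinRpowIntegral s θ ≤ θ * sin θ ^ s := by
  have hmono : ∀ φ ∈ Icc 0 θ, sin φ ^ s ≤ sin θ ^ s := fun φ hφ => by
    have hsin : 0 ≤ sin φ :=
      sin_nonneg_of_nonneg_of_le_pi hφ.1 (by linarith [hφ.2, hθ.2, pi_pos])
    gcongr
    exact sin_le_sin_of_le_of_le_pi_div_two (by linarith [hφ.1, pi_pos]) hθ.2 hφ.2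
  simpa [sinRpowIntegral] using intervalIntegral.integral_mono_on hθ.1
    (intervalIntegrable_sin_rpow hs 0 θ) intervalIntegrable_const hmono

theorem continuousOn_sinRpowIntegral_div_sin_rpow (hs : 0 ≤ s) :
    ContinuousOn (fun t => sinRpowIntegral s t / sin t ^ s) (Ico 0 π) := by
  intro t ht
  rcases ht.1.eq_or_lt with rfl | ht0
  · have hnear : ∀ᶠ x : ℝ in 𝓝[Ico 0 π] 0, x ∈ Icc 0 (π / 2) := by
      filter_upwards [self_mem_nhdsWithin, nhdsWithin_le_nhds (Iio_mem_nhds (half_pos pi_pos))]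
        with x hx hx' using ⟨hx.1, le_of_lt hx'⟩
    have hid : Tendsto (fun x : ℝ => x) (𝓝[Ico 0 π] 0) (𝓝 0) := nhdsWithin_le_nhds
    rw [ContinuousWithinAt, sinRpowIntegral_apply_zero, zero_div]
    refine tendsto_of_tendsto_of_tendsto_of_le_of_le' tendsto_const_nhds hid ?_ ?_
    · filter_upwards [self_mem_nhdsWithin] with x hx
      have hsin := rpow_nonneg (sin_nonneg_of_mem_Icc (Ico_subset_Icc_self hx)) s
      exact div_nonneg (intervalIntegral.integral_nonneg hx.1 fun φ hφ => rpow_nonneg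
        (sin_nonneg_of_nonneg_of_le_pi hφ.1 (hφ.2.trans hx.2.le)) s) hsin
    · filter_upwards [hnear] with x hx
      have hsin : 0 ≤ sin x ^ s := rpow_nonneg
        (sin_nonneg_of_nonneg_of_le_pi hx.1 (by linarith [hx.2, pi_pos])) s
      exact div_le_of_le_mul₀ hsin hx.1 (sinRpowIntegral_le_mul_sin_rpow hs hx)
  · have hsin := rpow_pos_of_pos (sin_pos_of_pos_of_lt_pi ht0 ht.2) s
    exact ((continuous_sinRpowIntegral hs).continuousAt.div
      (continuous_sin_rpow hs).continuousAt hsin.ne').continuousWithinAt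

end SinRpowIntegral

section ExponentDerivative

theorem abs_rpow_sub_rpow_le {x a b : ℝ} (hx₀ : 0 < x) (hx₁ : x ≤ 1) (ha : 0 ≤ a) (hb : 0 ≤ b) :
    |x ^ b - x ^ a| ≤ |log x| * |b - a| := by
  refine Convex.norm_image_sub_le_of_norm_hasDerivWithin_le (s := Ici (0 : ℝ))
    (f := fun y => x ^ y) (f' := fun y => x ^ y * log x)
    (fun y _ => (hasStrictDerivAt_const_rpow hx₀ y).hasDerivAt.hasDerivWithinAt)
    (fun y hy => ?_) (convex_Ici 0) ha hb
  rw [norm_mul, norm_eq_abs, norm_eq_abs, abs_of_pos (rpow_pos_of_pos hx₀ y)]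
  exact mul_le_of_le_one_left (abs_nonneg _) (rpow_le_one hx₀.le hx₁ hy)

theorem hasDerivWithinAt_sinRpowIntegral_exponent {s₀ θ : ℝ} (hs₀ : 0 ≤ s₀) (hθ : θ ∈ Ico 0 π) :
    HasDerivWithinAt (fun s => sinRpowIntegral s θ)
      (∫ φ in (0 : ℝ)..θ, sin φ ^ s₀ * log (sin φ)) (Ici 0) s₀ := by
  have hsin : ∀ φ ∈ uIoc 0 θ, 0 < sin φ := fun φ hφ => by
    rw [uIoc_of_le hθ.1] at hφ
    exact sin_pos_of_pos_of_lt_pi hφ.1 (hφ.2.trans_lt hθ.2)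
  rw [hasDerivWithinAt_iff_tendsto_slope]
  have hlim : Tendsto (fun s => ∫ φ in (0 : ℝ)..θ, (sin φ ^ s - sin φ ^ s₀) / (s - s₀))
      (𝓝[Ici 0 \ {s₀}] s₀) (𝓝 (∫ φ in (0 : ℝ)..θ, sin φ ^ s₀ * log (sin φ))) := by
    refine intervalIntegral.tendsto_integral_filter_of_dominated_convergence
      (fun φ => |log (sin φ)|) ?_ ?_ intervalIntegrable_log_sin.abs ?_
    · filter_upwards [self_mem_nhdsWithin] with s hs
      exact (((continuous_sin_rpow hs.1).sub
        (continuous_sin_rpow hs₀)).div_const _).aestronglyMeasurable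
    · filter_upwards [self_mem_nhdsWithin] with s hs
      refine Eventually.of_forall fun φ hφ => ?_
      rw [norm_div, norm_eq_abs, norm_eq_abs, div_le_iff₀ (abs_pos.2 (sub_ne_zero.2 hs.2))]
      exact abs_rpow_sub_rpow_le (hsin φ hφ) (sin_le_one φ) hs₀ hs.1
    · refine Eventually.of_forall fun φ hφ => ?_
      have h := (hasStrictDerivAt_const_rpow (hsin φ hφ) s₀).hasDerivAt.hasDerivWithinAt
        (s := Ici 0)
      rw [hasDerivWithinAt_iff_tendsto_slope] at h
      exact h.congr fun s => slope_def_field _ _ _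
  refine hlim.congr' ?_
  filter_upwards [self_mem_nhdsWithin] with s hs
  rw [intervalIntegral.integral_div, intervalIntegral.integral_sub
    (intervalIntegrable_sin_rpow hs.1 _ _) (intervalIntegrable_sin_rpow hs₀ _ _),
    slope_def_field, sinRpowIntegral, sinRpowIntegral]

end ExponentDerivative

section YoungAngle

/-- The angle `θ ∈ [0, π]` with `Φ_s(θ) = (1 + σ) Φ_s(π / 2)`, for `s ≥ 0` and `σ ∈ [-1, 1]`
(arbitrary otherwise). It is the contact angle for `s > 0`, and extends it to `s = 0`, where
`youngM` has a divergent radial integral. -/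
noncomputable def youngAngle (s σ : ℝ) : ℝ :=
  Function.invFunOn (sinRpowIntegral s) (Icc 0 π) ((1 + σ) * sinRpowIntegral s (π / 2))

variable {s σ α : ℝ}

theorem exists_sinRpowIntegral_eq (hs : 0 ≤ s) (hσ : σ ∈ Icc (-1) 1) :
    ∃ α ∈ Icc 0 π, sinRpowIntegral s α = (1 + σ) * sinRpowIntegral s (π / 2) := by
  have hΦ := sinRpowIntegral_pi_div_two_pos hs
  refine intermediate_value_Icc pi_pos.le (continuous_sinRpowIntegral hs).continuousOn ?_
  rw [sinRpowIntegral_apply_zero, sinRpowIntegral_apply_pi hs]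
  exact ⟨mul_nonneg (by linarith [hσ.1]) hΦ.le,
    mul_le_mul_of_nonneg_right (by linarith [hσ.2]) hΦ.le⟩

theorem youngAngle_mem_Icc (hs : 0 ≤ s) (hσ : σ ∈ Icc (-1) 1) : youngAngle s σ ∈ Icc 0 π :=
  Function.invFunOn_mem (exists_sinRpowIntegral_eq hs hσ)

theorem sinRpowIntegral_youngAngle (hs : 0 ≤ s) (hσ : σ ∈ Icc (-1) 1) :
    sinRpowIntegral s (youngAngle s σ) = (1 + σ) * sinRpowIntegral s (π / 2) :=
  Function.invFunOn_eq (exists_sinRpowIntegral_eq hs hσ)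

theorem eq_youngAngle_iff (hs : 0 ≤ s) (hσ : σ ∈ Icc (-1) 1) (hα : α ∈ Icc 0 π) :
    α = youngAngle s σ ↔ sinRpowIntegral s α = (1 + σ) * sinRpowIntegral s (π / 2) := by
  rw [← sinRpowIntegral_youngAngle hs hσ,
    (strictMonoOn_sinRpowIntegral hs).injOn.eq_iff hα (youngAngle_mem_Icc hs hσ)]

theorem lt_youngAngle_iff (hs : 0 ≤ s) (hσ : σ ∈ Icc (-1) 1) (hα : α ∈ Icc 0 π) :
    α < youngAngle s σ ↔ sinRpowIntegral s α < (1 + σ) * sinRpowIntegral s (π / 2) := by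
  rw [← sinRpowIntegral_youngAngle hs hσ,
    (strictMonoOn_sinRpowIntegral hs).lt_iff_lt hα (youngAngle_mem_Icc hs hσ)]

theorem youngAngle_lt_iff (hs : 0 ≤ s) (hσ : σ ∈ Icc (-1) 1) (hα : α ∈ Icc 0 π) :
    youngAngle s σ < α ↔ (1 + σ) * sinRpowIntegral s (π / 2) < sinRpowIntegral s α := by
  rw [← sinRpowIntegral_youngAngle hs hσ,
    (strictMonoOn_sinRpowIntegral hs).lt_iff_lt (youngAngle_mem_Icc hs hσ) hα]

theorem strictMonoOn_youngAngle (hs : 0 ≤ s) : StrictMonoOn (youngAngle s) (Icc (-1) 1) := by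
  intro σ hσ τ hτ hστ
  rw [lt_youngAngle_iff hs hτ (youngAngle_mem_Icc hs hσ), sinRpowIntegral_youngAngle hs hσ]
  exact mul_lt_mul_of_pos_right (by linarith) (sinRpowIntegral_pi_div_two_pos hs)

theorem youngAngle_mem_Ioo (hs : 0 ≤ s) (hσ : σ ∈ Ioo (-1) 1) : youngAngle s σ ∈ Ioo 0 π := by
  have hσ' := Ioo_subset_Icc_self hσ
  have hΦ := sinRpowIntegral_pi_div_two_pos hs
  constructor
  · rw [lt_youngAngle_iff hs hσ' (left_mem_Icc.2 pi_pos.le), sinRpowIntegral_apply_zero]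
    exact mul_pos (by linarith [hσ.1]) hΦ
  · rw [youngAngle_lt_iff hs hσ' (right_mem_Icc.2 pi_pos.le), sinRpowIntegral_apply_pi hs]
    exact mul_lt_mul_of_pos_right (by linarith [hσ.2]) hΦ

theorem youngAngle_zero (hσ : σ ∈ Icc (-1) 1) : youngAngle 0 σ = π / 2 * (1 + σ) := by
  refine ((eq_youngAngle_iff le_rfl hσ ⟨?_, ?_⟩).2 ?_).symm
  · exact mul_nonneg (half_pos pi_pos).le (by linarith [hσ.1])
  · nlinarith [hσ.2, pi_pos]
  · simp [sinRpowIntegral_zero, mul_comm]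

theorem youngAngle_one (hσ : σ ∈ Icc (-1) 1) : youngAngle 1 σ = arccos (-σ) := by
  refine ((eq_youngAngle_iff zero_le_one hσ ⟨arccos_nonneg _, arccos_le_pi _⟩).2 ?_).symm
  simp [sinRpowIntegral_one, cos_arccos (by linarith [hσ.2] : -1 ≤ -σ) (by linarith [hσ.1])]

theorem continuousOn_youngAngle_exponent (hσ : σ ∈ Ioo (-1) 1) :
    ContinuousOn (fun s => youngAngle s σ) (Ici 0) := by
  intro s₀ hs₀
  have hσ' := Ioo_subset_Icc_self hσ
  have hΦ : ∀ θ ∈ Ico 0 π, Tendsto (fun s => sinRpowIntegral s θ) (𝓝[Ici 0] s₀)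
      (𝓝 (sinRpowIntegral s₀ θ)) := fun θ hθ =>
    (hasDerivWithinAt_sinRpowIntegral_exponent hs₀ hθ).continuousWithinAt
  have hrhs := (hΦ _ (Ioo_subset_Ico_self pi_div_two_mem_Ioo)).const_mul (1 + σ)
  have hmem := youngAngle_mem_Ioo hs₀ hσ
  refine tendsto_order.2 ⟨fun a (ha : a < youngAngle s₀ σ) => ?_,
    fun b (hb : youngAngle s₀ σ < b) => ?_⟩
  · rcases lt_or_ge a 0 with ha₀ | ha₀
    · filter_upwards [self_mem_nhdsWithin] with s hs
        using ha₀.trans (youngAngle_mem_Ioo hs hσ).1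
    · have haπ : a ∈ Ico 0 π := ⟨ha₀, ha.trans hmem.2⟩
      rw [lt_youngAngle_iff hs₀ hσ' (Ico_subset_Icc_self haπ)] at ha
      filter_upwards [self_mem_nhdsWithin, (hΦ a haπ).eventually_lt hrhs ha] with s hs hlt
        using (lt_youngAngle_iff hs hσ' (Ico_subset_Icc_self haπ)).2 hlt
  · rcases le_or_gt π b with hbπ | hbπ
    · filter_upwards [self_mem_nhdsWithin] with s hs
        using (youngAngle_mem_Ioo hs hσ).2.trans_le hbπ
    · have hbπ : b ∈ Ico 0 π := ⟨(hmem.1.trans hb).le, hbπ⟩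
      rw [youngAngle_lt_iff hs₀ hσ' (Ico_subset_Icc_self hbπ)] at hb
      filter_upwards [self_mem_nhdsWithin, hrhs.eventually_lt (hΦ b hbπ) hb] with s hs hlt
        using (youngAngle_lt_iff hs hσ' (Ico_subset_Icc_self hbπ)).2 hlt

theorem hasDerivWithinAt_youngAngle_exponent {s₀ : ℝ} (hs₀ : 0 ≤ s₀) (hσ : σ ∈ Ioo (-1) 1) :
    HasDerivWithinAt (fun s => youngAngle s σ)
      (((1 + σ) * (∫ φ in (0 : ℝ)..(π / 2), sin φ ^ s₀ * log (sin φ)) -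
        ∫ φ in (0 : ℝ)..youngAngle s₀ σ, sin φ ^ s₀ * log (sin φ)) /
          sin (youngAngle s₀ σ) ^ s₀) (Ici 0) s₀ := by
  have hmem := youngAngle_mem_Ioo hs₀ hσ
  have hsin := sin_pos_of_mem_Ioo hmem
  have hcont : ContinuousAt (Function.uncurry fun s x : ℝ => sin x ^ s)
      (s₀, youngAngle s₀ σ) :=
    (continuous_sin.comp continuous_snd).continuousAt.rpow continuousAt_fst (Or.inl hsin.ne')
  have hexp := (hasDerivWithinAt_sinRpowIntegral_exponent hs₀ (Ioo_subset_Ico_self hmem)).sub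
    ((hasDerivWithinAt_sinRpowIntegral_exponent hs₀
      (Ioo_subset_Ico_self pi_div_two_mem_Ioo)).const_mul (1 + σ))
  have himplicit := hasDerivWithinAt_implicit
    (G := fun s x => sinRpowIntegral s x - (1 + σ) * sinRpowIntegral s (π / 2))
    hs₀ (continuousOn_youngAngle_exponent hσ s₀ hs₀)
    (fun s hs => sub_eq_zero.2 (sinRpowIntegral_youngAngle hs (Ioo_subset_Icc_self hσ)))
    (fun s hs x => (hasDerivAt_sinRpowIntegral hs x).sub_const _)
    hcont.continuousWithinAt (rpow_pos_of_pos hsin s₀).ne' hexp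
  rwa [neg_sub] at himplicit

end YoungAngle

section RadialIntegral

/-- The argument of the complex number `r + e^{it}`, for `t ∈ (0, π)`. As a variable of integration
it turns the radial integral in `youngM` into an integral of powers of the sine. -/
noncomputable def radialAngle (t r : ℝ) : ℝ := π / 2 - arctan ((r + cos t) / sin t)

variable {s t : ℝ}

theorem radialAngle_mem_Ioo (t r : ℝ) : radialAngle t r ∈ Ioo 0 π := by
  have h := arctan_mem_Ioo ((r + cos t) / sin t)
  exact ⟨sub_pos.2 h.2, by rw [radialAngle]; linarith [h.1]⟩

theorem sin_radialAngle_pos (t r : ℝ) : 0 < sin (radialAngle t r) :=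
  sin_pos_of_mem_Ioo (radialAngle_mem_Ioo t r)

theorem radialAngle_zero (ht : t ∈ Ioo 0 π) : radialAngle t 0 = t := by
  have hcot : cos t / sin t = tan (π / 2 - t) := by
    rw [tan_pi_div_two_sub, tan_eq_sin_div_cos, inv_div]
  rw [radialAngle, zero_add, hcot, arctan_tan (by linarith [ht.2]) (by linarith [ht.1]),
    sub_sub_cancel]

theorem tendsto_radialAngle_atTop (ht : 0 < sin t) :
    Tendsto (radialAngle t) atTop (𝓝 0) := by
  have hcot : Tendsto (fun r : ℝ => (r + cos t) / sin t) atTop atTop :=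
    (tendsto_atTop_add_const_right _ _ tendsto_id).atTop_div_const ht
  have h := (tendsto_arctan_atTop.mono_right nhdsWithin_le_nhds).comp hcot
  rw [← sub_self (π / 2)]
  exact h.const_sub (π / 2)

theorem sin_mul_cos_radialAngle (ht : sin t ≠ 0) (r : ℝ) :
    sin t * cos (radialAngle t r) = (r + cos t) * sin (radialAngle t r) := by
  rw [radialAngle, cos_pi_div_two_sub, sin_pi_div_two_sub, sin_arctan, cos_arctan]
  field_simp

theorem sq_add_two_mul_cos_add_one_eq (ht : sin t ≠ 0) (r : ℝ) :
    r ^ 2 + 2 * r * cos t + 1 = (sin t / sin (radialAngle t r)) ^ 2 := by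
  have hsin := (sin_radialAngle_pos t r).ne'
  have hcot := sin_mul_cos_radialAngle ht r
  rw [div_pow, eq_div_iff (pow_ne_zero 2 hsin)]
  linear_combination (-(sin t * cos (radialAngle t r)) - (r + cos t) * sin (radialAngle t r)) * hcot
    + sin t ^ 2 * sin_sq_add_cos_sq (radialAngle t r)
    - sin (radialAngle t r) ^ 2 * sin_sq_add_cos_sq t

theorem hasDerivAt_radialAngle (t r : ℝ) :
    HasDerivAt (radialAngle t) (-(sin (radialAngle t r) ^ 2 / sin t)) r := by
  have h := ((((hasDerivAt_id r).add_const (cos t)).div_const (sin t)).arctan).const_sub (π / 2)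
  refine h.congr_deriv ?_
  rw [radialAngle, sin_pi_div_two_sub, cos_sq_arctan]
  simp only [id]
  ring

theorem radial_integrand_eq (ht : 0 < sin t) (r : ℝ) :
    r / (r ^ 2 + 2 * r * cos t + 1) ^ ((2 + s) / 2) =
      r * (sin (radialAngle t r) / sin t) ^ (2 + s) := by
  have hsin := sin_radialAngle_pos t r
  rw [sq_add_two_mul_cos_add_one_eq ht.ne', ← rpow_natCast, ← rpow_mul (by positivity),
    Nat.cast_ofNat, mul_div_cancel₀ _ two_ne_zero, div_eq_mul_inv, ← inv_rpow (by positivity),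
    inv_div]

theorem radial_integrand_nonneg (ht : 0 < sin t) {r : ℝ} (hr : 0 ≤ r) :
    0 ≤ r / (r ^ 2 + 2 * r * cos t + 1) ^ ((2 + s) / 2) := by
  have hsin := sin_radialAngle_pos t r
  rw [radial_integrand_eq ht]
  positivity

/-- A primitive of the integrand of the radial integral, vanishing at infinity. -/
noncomputable def radialPrimitive (s t r : ℝ) : ℝ :=
  cos t / sin t * (sinRpowIntegral s (radialAngle t r) / sin t ^ s) -
    (sin (radialAngle t r) / sin t) ^ s / s

theorem hasDerivAt_radialPrimitive (hs : 0 < s) (ht : 0 < sin t) (r : ℝ) :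
    HasDerivAt (radialPrimitive s t) (r / (r ^ 2 + 2 * r * cos t + 1) ^ ((2 + s) / 2)) r := by
  have hsin := sin_radialAngle_pos t r
  have hcot := sin_mul_cos_radialAngle ht.ne' r
  have hψ := hasDerivAt_radialAngle t r
  have hΦ := (((hasDerivAt_sinRpowIntegral hs.le _).comp r hψ).div_const (sin t ^ s)).const_mul
    (cos t / sin t)
  have hpow := (((hψ.sin.div_const (sin t)).rpow_const (p := s)
    (Or.inl (div_pos hsin ht).ne')).div_const s)
  refine (hΦ.sub hpow).congr_deriv ?_
  rw [radial_integrand_eq ht, rpow_sub_one (div_pos hsin ht).ne', rpow_add (div_pos hsin ht),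
    rpow_two, div_rpow hsin.le ht.le]
  have := rpow_pos_of_pos ht s
  field_simp
  linear_combination hcot

theorem tendsto_radialPrimitive_atTop (hs : 0 < s) (ht : 0 < sin t) :
    Tendsto (radialPrimitive s t) atTop (𝓝 0) := by
  have hcont : Continuous fun ψ => cos t / sin t * (sinRpowIntegral s ψ / sin t ^ s) -
      (sin ψ / sin t) ^ s / s :=
    (((continuous_sinRpowIntegral hs.le).div_const _).const_mul _).sub
      (((continuous_sin.div_const _).rpow_const fun _ => Or.inr hs.le).div_const s)
  have h := (hcont.tendsto 0).comp (tendsto_radialAngle_atTop ht)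
  simpa [hs.ne', Function.comp_def, radialPrimitive] using! h

theorem integral_radial (hs : 0 < s) (ht : t ∈ Ioo 0 π) :
    ∫ r in Ioi (0 : ℝ), r / (r ^ 2 + 2 * r * cos t + 1) ^ ((2 + s) / 2) =
      1 / s - cos t / sin t * (sinRpowIntegral s t / sin t ^ s) := by
  have hst := sin_pos_of_mem_Ioo ht
  rw [integral_Ioi_of_hasDerivAt_of_nonneg' (fun r _ => hasDerivAt_radialPrimitive hs hst r)
    (fun r hr => radial_integrand_nonneg hst (le_of_lt hr)) (tendsto_radialPrimitive_atTop hs hst),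
    radialPrimitive, radialAngle_zero ht, div_self hst.ne', one_rpow]
  ring

end RadialIntegral

section FractionalYoungLaw

variable {s σ α θ : ℝ}

theorem hasDerivAt_sinRpowIntegral_div_sin_rpow {t : ℝ} (hs : 0 < s) (ht : t ∈ Ioo 0 π) :
    HasDerivAt (fun t => sinRpowIntegral s t / sin t ^ s / s)
      (∫ r in Ioi (0 : ℝ), r / (r ^ 2 + 2 * r * cos t + 1) ^ ((2 + s) / 2)) t := by
  have hst := sin_pos_of_mem_Ioo ht
  have hpow := rpow_pos_of_pos hst s
  have h := ((hasDerivAt_sinRpowIntegral hs.le t).div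
    ((hasDerivAt_sin t).rpow_const (p := s) (Or.inl hst.ne')) hpow.ne').div_const s
  refine h.congr_deriv ?_
  rw [integral_radial hs ht, rpow_sub_one hst.ne']
  field_simp

theorem youngM_eq (hs : 0 < s) (hθ : θ ∈ Ico 0 π) :
    youngM θ s = 2 * (sinRpowIntegral s θ / sin θ ^ s / s) := by
  have hcont : ContinuousOn (fun t => sinRpowIntegral s t / sin t ^ s / s) (Icc 0 θ) :=
    ((continuousOn_sinRpowIntegral_div_sin_rpow hs.le).mono
      fun t ht => ⟨ht.1, ht.2.trans_lt hθ.2⟩).div_const s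
  have hmem : ∀ t ∈ Ioo 0 θ, t ∈ Ioo 0 π := fun t ht => ⟨ht.1, ht.2.trans hθ.2⟩
  have hderiv := fun t ht => hasDerivAt_sinRpowIntegral_div_sin_rpow hs (hmem t ht)
  have hint := intervalIntegral.integrableOn_deriv_of_nonneg hcont hderiv fun t ht =>
    setIntegral_nonneg measurableSet_Ioi fun r hr =>
      radial_integrand_nonneg (sin_pos_of_mem_Ioo (hmem t ht)) (le_of_lt hr)
  rw [youngM, intervalIntegral.integral_eq_sub_of_hasDerivAt_of_le hθ.1 hcont hderiv
    ((intervalIntegrable_iff_integrableOn_Ioc_of_le hθ.1).2 hint)]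
  simp only [sinRpowIntegral_apply_zero, zero_div, sub_zero]

theorem isContactAngle_iff (hs : 0 < s) :
    IsContactAngle s σ α ↔
      α ∈ Ioo 0 π ∧ sinRpowIntegral s α = (1 + σ) * sinRpowIntegral s (π / 2) := by
  refine and_congr_right fun hα => ?_
  have hpow := rpow_pos_of_pos (sin_pos_of_mem_Ioo hα) s
  have hΦ := sinRpowIntegral_pi_div_two_pos hs.le
  have hratio : sin α ^ s * (youngM α s / youngM (π / 2) s) =
      sinRpowIntegral s α / sinRpowIntegral s (π / 2) := by
    rw [youngM_eq hs (Ioo_subset_Ico_self hα),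
      youngM_eq hs (Ioo_subset_Ico_self pi_div_two_mem_Ioo), sin_pi_div_two, one_rpow]
    field_simp
  rw [hratio, eq_div_iff hΦ.ne', eq_comm]

theorem isContactAngle_iff_eq_youngAngle (hs : 0 < s) (hσ : σ ∈ Ioo (-1) 1) :
    IsContactAngle s σ α ↔ α = youngAngle s σ := by
  rw [isContactAngle_iff hs]
  constructor
  · rintro ⟨hα, h⟩
    exact (eq_youngAngle_iff hs.le (Ioo_subset_Icc_self hσ) (Ioo_subset_Icc_self hα)).2 h
  · rintro rfl
    exact ⟨youngAngle_mem_Ioo hs.le hσ,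
      sinRpowIntegral_youngAngle hs.le (Ioo_subset_Icc_self hσ)⟩

theorem contactAngle_eq_youngAngle (hs : 0 < s) (hσ : σ ∈ Ioo (-1) 1) :
    contactAngle s σ = youngAngle s σ :=
  (isContactAngle_iff_eq_youngAngle hs hσ).1 <|
    Classical.epsilon_spec ⟨_, (isContactAngle_iff_eq_youngAngle hs hσ).2 rfl⟩

theorem isContactAngle_iff_eq_contactAngle (hs : 0 < s) (hσ : σ ∈ Ioo (-1) 1) :
    IsContactAngle s σ α ↔ α = contactAngle s σ := by
  rw [contactAngle_eq_youngAngle hs hσ, isContactAngle_iff_eq_youngAngle hs hσ]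

theorem strictMonoOn_contactAngle (hs : 0 < s) : StrictMonoOn (contactAngle s) (Ioo (-1) 1) :=
  ((strictMonoOn_youngAngle hs.le).mono Ioo_subset_Icc_self).congr
    fun _ hσ => (contactAngle_eq_youngAngle hs hσ).symm

end FractionalYoungLaw

section LogSineIntegrals

variable {θ : ℝ}

theorem hasDerivAt_primitive_sin_mul_log_sin {x : ℝ} (hx : sin x ≠ 0) :
    HasDerivAt (fun x => ((1 - cos x) * log (1 - cos x) - (1 + cos x) * log (1 + cos x)) / 2 -
      (1 - cos x)) (sin x * log (sin x)) x := by
  have hsq : (1 - cos x) * (1 + cos x) = sin x ^ 2 := by linear_combination -sin_sq_add_cos_sq x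
  have hne : (1 - cos x) * (1 + cos x) ≠ 0 := hsq ▸ pow_ne_zero 2 hx
  have hminus := left_ne_zero_of_mul hne
  have hplus := right_ne_zero_of_mul hne
  have hlog : log (1 - cos x) + log (1 + cos x) = 2 * log (sin x) := by
    rw [← log_mul hminus hplus, hsq, log_pow, Nat.cast_ofNat]
  have hcos_minus := (hasDerivAt_cos x).const_sub 1
  have hcos_plus := (hasDerivAt_cos x).const_add 1
  refine (((((hasDerivAt_mul_log hminus).comp x hcos_minus).sub
    ((hasDerivAt_mul_log hplus).comp x hcos_plus)).div_const 2).sub hcos_minus).congr_deriv ?_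
  linear_combination (1 / 2 * sin x) * hlog

theorem integral_sin_mul_log_sin (hθ : θ ∈ Icc 0 π) :
    ∫ φ in (0 : ℝ)..θ, sin φ * log (sin φ) =
      ((1 - cos θ) * log (1 - cos θ) - (1 + cos θ) * log (1 + cos θ)) / 2 -
        (1 - cos θ) + log 2 := by
  have hcont : Continuous fun x : ℝ =>
      ((1 - cos x) * log (1 - cos x) - (1 + cos x) * log (1 + cos x)) / 2 - (1 - cos x) :=
    (((continuous_const.sub continuous_cos).mul_log.sub
      (continuous_const.add continuous_cos).mul_log).div_const 2).sub
        (continuous_const.sub continuous_cos)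
  rw [intervalIntegral.integral_eq_sub_of_hasDerivAt_of_le hθ.1 hcont.continuousOn
    (fun x hx => hasDerivAt_primitive_sin_mul_log_sin
      (sin_pos_of_pos_of_lt_pi hx.1 (hx.2.trans_le hθ.2)).ne')
    (continuous_sin.mul_log.intervalIntegrable _ _), cos_zero]
  norm_num
  ring

theorem sinc_pos {t : ℝ} (ht : t ∈ Ico 0 π) : 0 < sinc t := by
  rcases ht.1.eq_or_lt with rfl | ht₀
  · simp
  · rw [sinc_of_ne_zero ht₀.ne']
    exact div_pos (sin_pos_of_pos_of_lt_pi ht₀ ht.2) ht₀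

theorem intervalIntegrable_div_tan (hθ : θ ∈ Ico 0 π) :
    IntervalIntegrable (fun t => t / tan t) volume 0 θ := by
  have hcont : ContinuousOn (fun t => cos t / sinc t) (uIcc 0 θ) := by
    rw [uIcc_of_le hθ.1]
    exact continuous_cos.continuousOn.div continuous_sinc.continuousOn fun t ht =>
      (sinc_pos ⟨ht.1, ht.2.trans_lt hθ.2⟩).ne'
  refine hcont.intervalIntegrable.congr fun t ht => ?_
  rw [uIoc_of_le hθ.1] at ht
  rw [sinc_of_ne_zero ht.1.ne', tan_eq_sin_div_cos, div_div_eq_mul_div, div_div_eq_mul_div,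
    mul_comm]

theorem continuousOn_mul_log_sin : ContinuousOn (fun t => t * log (sin t)) (Ico 0 π) := by
  have h : ContinuousOn (fun t => t * log t + t * log (sinc t)) (Ico 0 π) :=
    continuous_mul_log.continuousOn.add (continuousOn_id.mul
      (continuous_sinc.continuousOn.log fun t ht => (sinc_pos ht).ne'))
  refine h.congr fun t ht => ?_
  rcases ht.1.eq_or_lt with rfl | ht₀
  · simp
  · have hsin := sin_pos_of_pos_of_lt_pi ht₀ ht.2
    simp only [sinc_of_ne_zero ht₀.ne', log_div hsin.ne' ht₀.ne']
    ring

theorem hasDerivAt_mul_log_sin {t : ℝ} (ht : sin t ≠ 0) :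
    HasDerivAt (fun t => t * log (sin t)) (log (sin t) + t / tan t) t := by
  refine ((hasDerivAt_id t).mul ((hasDerivAt_sin t).log ht)).congr_deriv ?_
  rw [tan_eq_sin_div_cos, div_div_eq_mul_div, id, one_mul, mul_div_assoc]

theorem integral_log_sin_eq_sub_youngXi (hθ : θ ∈ Ico 0 π) :
    ∫ φ in (0 : ℝ)..θ, log (sin φ) = θ * log (sin θ) - youngXi θ := by
  have hlog : IntervalIntegrable (fun φ => log (sin φ)) volume 0 θ := intervalIntegrable_log_sin
  have hdiv := intervalIntegrable_div_tan hθ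
  have hFTC := intervalIntegral.integral_eq_sub_of_hasDerivAt_of_le hθ.1
    (continuousOn_mul_log_sin.mono fun t ht => ⟨ht.1, ht.2.trans_lt hθ.2⟩)
    (fun t ht => hasDerivAt_mul_log_sin (sin_pos_of_pos_of_lt_pi ht.1 (ht.2.trans hθ.2)).ne')
    (hlog.add hdiv)
  rw [intervalIntegral.integral_add hlog hdiv, zero_mul, sub_zero] at hFTC
  exact eq_sub_of_add_eq hFTC

end LogSineIntegrals

section Expansions

variable {σ : ℝ}

theorem hasDerivAt_youngAngle_one (hσ : σ ∈ Ioo (-1) 1) :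
    HasDerivAt (fun s => youngAngle s σ)
      ((2 * σ * log 2 + (1 - σ) * log (1 - σ) - (1 + σ) * log (1 + σ)) /
        (2 * √(1 - σ ^ 2))) 1 := by
  have hσ' := Ioo_subset_Icc_self hσ
  have hcos : cos (youngAngle 1 σ) = -σ := by
    rw [youngAngle_one hσ', cos_arccos (by linarith [hσ.2]) (by linarith [hσ.1])]
  have hsin : sin (youngAngle 1 σ) = √(1 - σ ^ 2) := by
    rw [youngAngle_one hσ', sin_arccos, neg_sq]
  refine ((hasDerivWithinAt_youngAngle_exponent zero_le_one hσ).hasDerivAt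
    (Ici_mem_nhds one_pos)).congr_deriv ?_
  simp only [rpow_one]
  rw [integral_sin_mul_log_sin (Ioo_subset_Icc_self pi_div_two_mem_Ioo),
    integral_sin_mul_log_sin (youngAngle_mem_Icc zero_le_one hσ'), hcos, hsin, cos_pi_div_two]
  simp only [sub_zero, add_zero, log_one, sub_neg_eq_add, ← sub_eq_add_neg]
  field_simp
  ring

theorem hasDerivWithinAt_youngAngle_zero (hσ : σ ∈ Ioo (-1) 1) :
    HasDerivWithinAt (fun s => youngAngle s σ)
      (-(π / 2 * (1 + σ) * log (cos (π * σ / 2)) - youngXi (π / 2 * (1 + σ)) +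
        (1 + σ) * youngXi (π / 2))) (Ici 0) 0 := by
  have hangle := youngAngle_zero (Ioo_subset_Icc_self hσ)
  have hmem := hangle ▸ youngAngle_mem_Ioo le_rfl hσ
  have hsin : sin (π / 2 * (1 + σ)) = cos (π * σ / 2) := by
    rw [← sin_add_pi_div_two]
    ring_nf
  refine (hasDerivWithinAt_youngAngle_exponent le_rfl hσ).congr_deriv ?_
  simp only [rpow_zero, one_mul, div_one]
  rw [hangle, integral_log_sin_eq_sub_youngXi (Ioo_subset_Ico_self hmem),
    integral_log_sin_eq_sub_youngXi (Ioo_subset_Ico_self pi_div_two_mem_Ioo), hsin,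
    sin_pi_div_two, log_one]
  ring

theorem contactAngle_isLittleO_one (hσ : σ ∈ Ioo (-1) 1) :
    (fun s => contactAngle s σ - (arccos (-σ) -
        (2 * σ * log 2 + (1 - σ) * log (1 - σ) - (1 + σ) * log (1 + σ)) /
          (2 * √(1 - σ ^ 2)) * (1 - s))) =o[𝓝 1] fun s => 1 - s := by
  refine ((hasDerivAt_iff_isLittleO.1 (hasDerivAt_youngAngle_one hσ)).congr' ?_
    EventuallyEq.rfl).neg_right.congr_right fun s => neg_sub s 1
  filter_upwards [Ioi_mem_nhds one_pos] with s hs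
  rw [contactAngle_eq_youngAngle hs hσ, youngAngle_one (Ioo_subset_Icc_self hσ), smul_eq_mul]
  ring

theorem contactAngle_isLittleO_zero (hσ : σ ∈ Ioo (-1) 1) :
    (fun s => contactAngle s σ - (π / 2 * (1 + σ) -
        (π / 2 * (1 + σ) * log (cos (π * σ / 2)) - youngXi (π / 2 * (1 + σ)) +
          (1 + σ) * youngXi (π / 2)) * s)) =o[𝓝[>] 0] fun s => s := by
  refine (((hasDerivWithinAt_iff_isLittleO.1 (hasDerivWithinAt_youngAngle_zero hσ)).mono
    (nhdsWithin_mono 0 Ioi_subset_Ici_self)).congr' ?_ EventuallyEq.rfl).congr_right sub_zero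
  filter_upwards [self_mem_nhdsWithin] with s hs
  rw [contactAngle_eq_youngAngle hs hσ, youngAngle_zero (Ioo_subset_Icc_self hσ), smul_eq_mul]
  ring

end Expansions

theorem theorem1p1_general :
    (∀ s > 0, ∀ σ ∈ Ioo (-1) 1, ∀ α, IsContactAngle s σ α ↔ α = contactAngle s σ) ∧
    (∀ s > 0, StrictMonoOn (contactAngle s) (Ioo (-1) 1)) ∧
    (∀ σ ∈ Ioo (-1) 1,
      (fun s => contactAngle s σ - (arccos (-σ) -
        (2 * σ * log 2 + (1 - σ) * log (1 - σ) - (1 + σ) * log (1 + σ)) /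
          (2 * √(1 - σ ^ 2)) * (1 - s))) =o[𝓝 1] fun s => 1 - s) ∧
    (∀ σ ∈ Ioo (-1) 1,
      (fun s => contactAngle s σ - (π / 2 * (1 + σ) -
        (π / 2 * (1 + σ) * log (cos (π * σ / 2)) - youngXi (π / 2 * (1 + σ)) +
          (1 + σ) * youngXi (π / 2)) * s)) =o[𝓝[>] 0] fun s => s) :=
  ⟨fun _ hs _ hσ _ => isContactAngle_iff_eq_contactAngle hs hσ,
    fun _ hs => strictMonoOn_contactAngle hs,
    fun _ hσ => contactAngle_isLittleO_one hσ,
    fun _ hσ => contactAngle_isLittleO_zero hσ⟩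

theorem theorem1p1 :
    (∀ s ∈ Set.Ioo (0 : ℝ) 1, ∀ σ ∈ Set.Ioo (-1 : ℝ) 1, ∀ α : ℝ,
      IsContactAngle s σ α ↔ α = contactAngle s σ) ∧
    (∀ s ∈ Set.Ioo (0 : ℝ) 1, StrictMonoOn (contactAngle s) (Set.Ioo (-1 : ℝ) 1)) ∧
    (∀ σ ∈ Set.Ioo (-1 : ℝ) 1,
      Asymptotics.IsLittleO (nhdsWithin (1 : ℝ) (Set.Iio 1))
        (fun s : ℝ => contactAngle s σ -
          (Real.arccos (-σ) -
            (2 * σ * Real.log 2 + (1 - σ) * Real.log (1 - σ) - (1 + σ) * Real.log (1 + σ)) /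
              (2 * Real.sqrt (1 - σ ^ 2)) * (1 - s)))
        (fun s : ℝ => 1 - s)) ∧
    (∀ σ ∈ Set.Ioo (-1 : ℝ) 1,
      Asymptotics.IsLittleO (nhdsWithin (0 : ℝ) (Set.Ioi 0))
        (fun s : ℝ => contactAngle s σ -
          (Real.pi / 2 * (1 + σ) -
            (Real.pi / 2 * (1 + σ) * Real.log (Real.cos (Real.pi * σ / 2)) -
              youngXi (Real.pi / 2 * (1 + σ)) + (1 + σ) * youngXi (Real.pi / 2)) * s))
        (fun s : ℝ => s)) := by
  obtain ⟨hunique, hmono, hone, hzero⟩ := theorem1p1_general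
  exact ⟨fun s hs => hunique s hs.1, fun s hs => hmono s hs.1,
    fun σ hσ => (hone σ hσ).mono nhdsWithin_le_nhds, hzero⟩
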